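/- **Theorem 1.1.** Let $(W,S)$ be a Coxeter system with $W$ finite, let $J\subseteq S$, and suppose that the standard parabolic subgroup $W_J=\langle J\rangle$ is core-free (it contains no non-trivial normal subgroup of $W$). Put $m=[W:W_J]$. Then for every $w\in W$ and every reduced expression of $w$ there is an Elnitsky tiling (E-tiling) of a $2m$-gon. More precisely: Let $W^J$ be the set of minimal length representatives of the left cosets $uW_J$, and $<_B$ the (strict) Bruhat order. A *total refinement* is a total order $\ll$ on $W^J$ such that $u<_Bv$ implies $u\ll v$ for $u,v\in W^J$. Numbering the cosets $1,\dots,m$ according to $\ll$, the action of $W$ on $W/W_J$ by left multiplication gives a homomorphism $\varphi=\varphi^J_\ll:W\to\mathrm{Sym}(m)$ (permutations acting on the left). Then total refinements exist, and for each of them the following holds. 1. $\varphi$ is a strong E-embedding, and in particular an E-embedding. That is, $\varphi$ is injective; $\varphi(u)<_B\varphi(v)$ whenever $u<_Rv$ in the weak right order; and for all $w\in W$ and $s\in S$ with $w<_Rws$ one has $\varphi(w)<_B\varphi(w)t$ for each of the disjoint transpositions $t$ whose product is $\varphi(s)$. Here $\mathrm{Sym}(m)$ is a Coxeter group with fundamental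 reflections $(i,i+1)$. 2. Let $-\pi/4<\theta_1<\dots<\theta_m<\pi/4$ and $e_i=(\sin\theta_i,\cos\theta_i)$. For $\sigma\in\mathrm{Sym}(m)$ let the border of $\sigma$ be the path with vertices $\sum_{i\le k}e_{\sigma(i)}$, $0\le k\le m$, and let $P(\sigma)$ be the (possibly degenerate) $2m$-gon, with unit edges, whose left half is the border of the identity and whose right half is the border of $\sigma$. Let $w\in W$, let $s_1\cdots s_r$ be a reduced expression of $w$, and put $w_j=s_1\cdots s_j$. Then there is an E-tiling of $P(\varphi(w))$ associated to this expression. That is, for $1\le j\le r$ the border of $\varphi(w_j)$ lies weakly to the right of the border of $\varphi(w_{j-1})$. Wherever these two borders separate at their $k$-th vertex and next meet at their $l$-th vertex, the two chains between these vertices have no further common point, so they bound a simple $2(l-k)$-gon, which is called a tile. The set of all tiles obtained for $j=1,\dots,r$ is finite, distinct tiles have disjoint interiors, and the tiles together with the left border (which matters only where the two halves of $P(\varphi(w))$ coincide) have union $P(\varphi(w))$. -/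

import Mathlib

open Equiv

/-! Coxeter groups, parabolic subgroups and orders -/

/-- The standard parabolic subgroup `W_J`, generated by the fundamental reflections in `J`. -/
def parabolic {B W : Type*} [Group W] {M : CoxeterMatrix B} (cs : CoxeterSystem M W)
    (J : Set B) : Subgroup W :=
  Subgroup.closure (cs.simple '' J)

/-- The strict Bruhat order attached to a length function `len` and a set of reflections `T`:
the transitive closure of `u < u t` for `t ∈ T` with `len u < len (u t)`. -/
def BruhatLT {G : Type*} [Group G] (len : G → ℕ) (T : Set G) : G → G → Prop :=
  Relation.TransGen fun u v => len u < len v ∧ ∃ t ∈ T, v = u * t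

/-- The strict Bruhat order of a Coxeter group. -/
def CoxBruhatLT {B W : Type*} [Group W] {M : CoxeterMatrix B} (cs : CoxeterSystem M W) :
    W → W → Prop :=
  BruhatLT cs.length {t | cs.IsReflection t}

/-- The strict weak right order of a Coxeter group. -/
def WeakLT {B W : Type*} [Group W] {M : CoxeterMatrix B} (cs : CoxeterSystem M W) :
    W → W → Prop :=
  Relation.TransGen fun u v => cs.length v = cs.length u + 1 ∧ ∃ i, v = u * cs.simple i

/-- The adjacent transpositions, i.e. the fundamental reflections of the symmetric group. -/
def adjSwaps (n : ℕ) : Set (Perm (Fin n)) :=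
  {s | ∃ i j : Fin n, (i : ℕ) + 1 = j ∧ s = swap i j}

/-- The Coxeter length of a permutation: the least number of adjacent transpositions in a
factorization of it. -/
noncomputable def symLength {n : ℕ} (σ : Perm (Fin n)) : ℕ :=
  sInf {k | ∃ l : List (Perm (Fin n)), (∀ s ∈ l, s ∈ adjSwaps n) ∧ l.prod = σ ∧ l.length = k}

/-- The strict Bruhat order of the symmetric group, whose reflections (the conjugates of the
adjacent transpositions) are all the transpositions. -/
def SymBruhatLT {n : ℕ} : Perm (Fin n) → Perm (Fin n) → Prop :=
  BruhatLT symLength {t | t.IsSwap}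

/-! E-embeddings.  Permutations act on the left here, so `φ w` below is the inverse of the
permutation that right-acting notation attaches to `w`; inversion is an isomorphism between the
two symmetric groups that fixes the adjacent transpositions. -/

/-- E-embeddings of a Coxeter group into a symmetric group. -/
def IsEEmbedding {B W : Type*} [Group W] {M : CoxeterMatrix B} (cs : CoxeterSystem M W)
    {n : ℕ} (φ : W →* Perm (Fin n)) : Prop :=
  Function.Injective φ ∧ ∀ u v : W, WeakLT cs u v → SymBruhatLT (φ u) (φ v)

/-- Strong E-embeddings.  The members of `cycleFactorsFinset` are the non-trivial disjoint cycles
of the involution `φ s`, i.e. the disjoint transpositions whose product it is. -/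
def IsStrongEEmbedding {B W : Type*} [Group W] {M : CoxeterMatrix B} (cs : CoxeterSystem M W)
    {n : ℕ} (φ : W →* Perm (Fin n)) : Prop :=
  Function.Injective φ ∧ ∀ (w : W) (i : B), WeakLT cs w (w * cs.simple i) →
    ∀ t ∈ (φ (cs.simple i)).cycleFactorsFinset, SymBruhatLT (φ w) (φ w * t)

/-- `u` has minimal length in its left coset `u W_J`, i.e. `u ∈ W^J`. -/
def IsMinRep {B W : Type*} [Group W] {M : CoxeterMatrix B} (cs : CoxeterSystem M W)
    (J : Set B) (u : W) : Prop :=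
  ∀ p ∈ parabolic cs J, cs.length u ≤ cs.length (u * p)

/-- A numbering of the left cosets of `W_J`, which is the same as a total order on their minimal
representatives, that refines the Bruhat order on `W^J`. -/
def IsBruhatNumbering {B W : Type*} [Group W] {M : CoxeterMatrix B} (cs : CoxeterSystem M W)
    (J : Set B) {n : ℕ} (f : W ⧸ parabolic cs J ≃ Fin n) : Prop :=
  ∀ u v : W, IsMinRep cs J u → IsMinRep cs J v → CoxBruhatLT cs u v →
    f (QuotientGroup.mk u) < f (QuotientGroup.mk v)

/-- The permutation representation of `W` on numbered left cosets of a subgroup: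
`w` sends the number of `x` to the number of `w • x`. -/
def cosetPerm {W : Type*} [Group W] {P : Subgroup W} {n : ℕ} (f : W ⧸ P ≃ Fin n) :
    W →* Perm (Fin n) :=
  (f.permCongrHom : Perm (W ⧸ P) →* Perm (Fin n)).comp (MulAction.toPermHom W (W ⧸ P))

/-! Polygons and tilings.  The plane is `ℝ × ℝ`, only used through coordinates. -/

/-- The angles, measured clockwise from the upward vertical, of the edges of the left half of the
polygon.  Read from the lowermost vertex, the edges turn clockwise. -/
def IsLeftHalf {n : ℕ} (θ : Fin n → ℝ) : Prop :=
  StrictMono θ ∧ ∀ i, θ i ∈ Set.Ioo (-(Real.pi / 4)) (Real.pi / 4)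

/-- The `k`-th vertex of the border of `σ`: start at the lowermost vertex `0` and let the edge in
position `i` be the unit vector that is parallel to the edge labelled `σ i` of the left half. -/
noncomputable def vertex {n : ℕ} (θ : Fin n → ℝ) (σ : Perm (Fin n)) (k : ℕ) : ℝ × ℝ :=
  ∑ i ∈ Finset.univ.filter (fun i : Fin n => i.val < k), (Real.sin (θ (σ i)), Real.cos (θ (σ i)))

/-- The part of the border of `σ` from its `k`-th to its `l`-th vertex. -/
def chain {n : ℕ} (θ : Fin n → ℝ) (σ : Perm (Fin n)) (k l : ℕ) : Set (ℝ × ℝ) :=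
  {p | ∃ j, k ≤ j ∧ j < l ∧ p ∈ segment ℝ (vertex θ σ j) (vertex θ σ (j + 1))}

/-- The whole border of `σ`, from the lowermost to the uppermost vertex of the polygon. -/
def border {n : ℕ} (θ : Fin n → ℝ) (σ : Perm (Fin n)) : Set (ℝ × ℝ) :=
  chain θ σ 0 n

/-- At every height, the points of `A` are weakly to the left of the points of `A'`. -/
def LeftOf (A A' : Set (ℝ × ℝ)) : Prop :=
  ∀ a ∈ A, ∀ b ∈ A', a.2 = b.2 → a.1 ≤ b.1

/-- The closed region with left boundary `A` and right boundary `A'`. -/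
def between (A A' : Set (ℝ × ℝ)) : Set (ℝ × ℝ) :=
  {p | ∃ a ∈ A, ∃ b ∈ A', a.2 = p.2 ∧ b.2 = p.2 ∧ a.1 ≤ p.1 ∧ p.1 ≤ b.1}

/-- The (closed, possibly deformed) `2n`-gon of `σ`: its left half consists of the edges labelled
`1, …, n` and its right half is the border of `σ`. -/
def polygon {n : ℕ} (θ : Fin n → ℝ) (σ : Perm (Fin n)) : Set (ℝ × ℝ) :=
  between (border θ 1) (border θ σ)

/-- The borders of `σ` and `τ` separate at their `k`-th vertex and meet again at their `l`-th
vertex.  The two chains from the one to the other have `2 (l - k)` edges, at least four. -/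
def IsTileSpan {n : ℕ} (θ : Fin n → ℝ) (σ τ : Perm (Fin n)) (k l : ℕ) : Prop :=
  k + 1 < l ∧ l ≤ n ∧ vertex θ σ k = vertex θ τ k ∧ vertex θ σ l = vertex θ τ l ∧
    ∀ j, k < j → j < l → vertex θ σ j ≠ vertex θ τ j

/-- The tiles that are placed when the border of `σ` is replaced by the border of `τ`. -/
def stepTiles {n : ℕ} (θ : Fin n → ℝ) (σ τ : Perm (Fin n)) : Set (Set (ℝ × ℝ)) :=
  {K | ∃ k l, IsTileSpan θ σ τ k l ∧ K = between (chain θ σ k l) (chain θ τ k l)}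

/-- The permutation of the current border after reading `j` letters of the word `ω`. -/
def borderPerm {B W : Type*} [Group W] {M : CoxeterMatrix B} (cs : CoxeterSystem M W)
    {n : ℕ} (φ : W →* Perm (Fin n)) (ω : List B) (j : ℕ) : Perm (Fin n) :=
  φ (cs.wordProd (ω.take j))

/-- `T` is the Elnitsky tiling, for the embedding `φ`, of the `2n`-gon of `φ w` that belongs to the
word `ω` of `w`. -/
structure IsETiling {B W : Type*} [Group W] {M : CoxeterMatrix B} (cs : CoxeterSystem M W)
    {n : ℕ} (φ : W →* Perm (Fin n)) (θ : Fin n → ℝ) (w : W) (ω : List B)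
    (T : Set (Set (ℝ × ℝ))) : Prop where
  /-- `ω` is a word for `w`, so that the last border is the right half of the polygon. -/
  word : cs.wordProd ω = w
  /-- Each letter moves the border to the right, never across the previous border. -/
  moves_right : ∀ j < ω.length,
    LeftOf (border θ (borderPerm cs φ ω j)) (border θ (borderPerm cs φ ω (j + 1)))
  /-- The tiles are those placed at the successive letters. -/
  tiles : T = ⋃ j < ω.length, stepTiles θ (borderPerm cs φ ω j) (borderPerm cs φ ω (j + 1))
  /-- The boundary of each tile is a simple closed polygon: its left and right chains, each of
  which goes strictly upwards, share exactly their two end points. -/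
  simple_tiles : ∀ j < ω.length, ∀ k l,
    IsTileSpan θ (borderPerm cs φ ω j) (borderPerm cs φ ω (j + 1)) k l →
    chain θ (borderPerm cs φ ω j) k l ∩ chain θ (borderPerm cs φ ω (j + 1)) k l =
      {vertex θ (borderPerm cs φ ω j) k, vertex θ (borderPerm cs φ ω j) l}
  finite : T.Finite
  /-- Distinct tiles do not overlap. -/
  disjoint : ∀ K ∈ T, ∀ K' ∈ T, K ≠ K' → Disjoint (interior K) (interior K')
  /-- The tiles fill the polygon.  The left border only matters where the polygon is pinched to a
  segment, because its two halves coincide there. -/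
  covers : polygon θ (φ w) = border θ 1 ∪ ⋃₀ T

/-! ### The reflection cocycle of a Coxeter group and Bruhat order on parabolic cosets. -/

section ReflectionCocycle

variable {B W : Type*} [Group W] {M : CoxeterMatrix B} (cs : CoxeterSystem M W)

/-! Let N(w, t) (`reflParity`) be the parity of the number of times that t occurs in the right
inversion sequence of a word for w. It does not depend on the word, because signed conjugation
satisfies the Coxeter relations. It is a cocycle, N(uv, t) = N(v, t) + N(u, vtv⁻¹), and for a
reflection t it vanishes exactly when ℓ(w) < ℓ(wt) (`length_lt_mul_iff_reflParity`). It also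
vanishes for w in W_J and t outside W_J. Hence, if u < ut and the cosets of u and ut differ, every
Bruhat numbering puts the coset of u first (`numbering_lt_of_length_lt`). Used at u and at wu with t
= u⁻¹su, this gives the key fact `cosetPerm_lt_of_length_lt`: if w < ws, then φ(w) is increasing on
each pair exchanged by φ(s).

Algebraically, exchanging the values at an ascent creates inversions, and inversions compute the
length in Sym(m). So multiplying φ(w) by one or by all of the transpositions of φ(s) goes up in
Bruhat order. Core-freeness of W_J makes φ injective.

Geometrically, such a step either fixes the k-th vertex of the border or adds to it differences of
unit vectors, each with the larger angle minus the smaller. The bound π/4 puts the edges in the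
upward quarter plane and these differences in the open rightward one. So borders are 1-Lipschitz
graphs over the vertical axis, and each letter of a reduced word moves vertices rightwards or not at
all (`stepRight_mul_involution`). The borders therefore sweep out the polygon from left to right,
and the regions between consecutive borders, cut at common vertices, are the tiles. -/

theorem Function.End.mul_apply {α : Type*} (f g : Function.End α) (x : α) :
    (f * g) x = f (g x) :=
  rfl

open Classical in
/-- The action of a simple reflection on signed group elements: conjugation, with a change of sign
at the simple reflection itself. -/
noncomputable def signedConj (i : B) : Function.End (W × ZMod 2) := fun x =>
  (cs.simple i * x.1 * cs.simple i, x.2 + if x.1 = cs.simple i then 1 else 0)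

/-- Conjugation by `cs.simple j` inverts the rotation `cs.simple i * cs.simple j`. -/
theorem conj_pow_simple (i j : B) (k : ℕ) :
    (cs.simple i * cs.simple j) ^ k * cs.simple j * (cs.simple i * cs.simple j) ^ k =
      cs.simple j := by
  induction k with
  | zero => simp
  | succ k ih =>
    calc _ = (cs.simple i * cs.simple j) ^ k * (cs.simple i * (cs.simple j * cs.simple j) *
          (cs.simple i * cs.simple j)) * (cs.simple i * cs.simple j) ^ k := by
            nth_rw 1 [pow_succ]
            rw [pow_succ']
            simp only [mul_assoc]
      _ = (cs.simple i * cs.simple j) ^ k * cs.simple j * (cs.simple i * cs.simple j) ^ k := by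
            simp
      _ = _ := ih

/-- The cases `x = 1` and `x = cs.simple i * cs.simple j` tell when the two factors of the next
rotation change the sign. -/
theorem conj_pow_eq_iff (i j : B) (k : ℕ) (t x : W) :
    (cs.simple i * cs.simple j) ^ k * t * ((cs.simple i * cs.simple j) ^ k)⁻¹ =
      cs.simple j * x ↔
    t = cs.simple j * (cs.simple i * cs.simple j) ^ k * x * (cs.simple i * cs.simple j) ^ k := by
  have h := conj_pow_simple cs i j k
  set c := (cs.simple i * cs.simple j) ^ k
  have h' : c⁻¹ * cs.simple j = cs.simple j * c := by
    rw [inv_mul_eq_iff_eq_mul, ← mul_assoc, h]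
  rw [mul_inv_eq_iff_eq_mul, ← eq_inv_mul_iff_mul_eq, ← h']
  simp only [mul_assoc]

open Classical in
-- The sum runs over the reflections of the dihedral group at which a sign change occurs. The
-- (k+1)-st rotation contributes the terms `r = 2 * k` (from `j`) and `r = 2 * k + 1` (from `i`).
theorem signedConj_pow (i j : B) (k : ℕ) (t : W) (e : ZMod 2) :
    ((signedConj cs i * signedConj cs j) ^ k : Function.End (W × ZMod 2)) (t, e) =
      ((cs.simple i * cs.simple j) ^ k * t * ((cs.simple i * cs.simple j) ^ k)⁻¹,
        e + ∑ r ∈ Finset.range (2 * k),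
          if t = cs.simple j * (cs.simple i * cs.simple j) ^ r then 1 else 0) := by
  induction k with
  | zero => simp [Function.End.one_def]
  | succ k ih =>
    rw [pow_succ', Function.End.mul_apply, ih, Function.End.mul_apply]
    have h1 := conj_pow_eq_iff cs i j k t 1
    have h2 := conj_pow_eq_iff cs i j k t (cs.simple i * cs.simple j)
    simp only [signedConj, Prod.mk.injEq]
    refine ⟨by simp [pow_succ', mul_assoc], ?_⟩
    rw [show 2 * (k + 1) = 2 * k + 1 + 1 by ring, Finset.sum_range_succ, Finset.sum_range_succ,
      add_assoc, add_assoc, add_assoc]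
    congr 3
    · rw [mul_one] at h1
      rw [h1, two_mul, pow_add]
      simp [mul_assoc]
    · have : cs.simple j * ((cs.simple i * cs.simple j) ^ k * t *
          ((cs.simple i * cs.simple j) ^ k)⁻¹) * cs.simple j = cs.simple i ↔
          (cs.simple i * cs.simple j) ^ k * t * ((cs.simple i * cs.simple j) ^ k)⁻¹ =
          cs.simple j * (cs.simple i * cs.simple j) := by
        rw [← mul_right_inj (cs.simple j), ← mul_left_inj (cs.simple j)]
        simp [mul_assoc]
      refine if_congr ?_ rfl rfl
      rw [this, h2, mul_assoc (cs.simple j), ← pow_succ, mul_assoc, ← pow_add,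
        show k + 1 + k = 2 * k + 1 by ring]

/-- For k = `M i j` the 2k reflections in the sum repeat with period k, so the sign changes cancel
in pairs. -/
theorem isLiftable_signedConj : M.IsLiftable (signedConj cs) := by
  classical
  intro i j
  funext ⟨t, e⟩
  rw [signedConj_pow, two_mul, Finset.sum_range_add]
  simp only [pow_add, cs.simple_mul_simple_pow, one_mul, CharTwo.add_self_eq_zero]
  simp [Function.End.one_def]

/-- The parity of the number of times that the reflection `t` occurs as a right inversion along a
word for `w`. -/
noncomputable def reflParity (w t : W) : ZMod 2 :=
  (cs.lift ⟨signedConj cs, isLiftable_signedConj cs⟩ w (t, 0)).2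

theorem lift_signedConj_apply (w t : W) (e : ZMod 2) :
    cs.lift ⟨signedConj cs, isLiftable_signedConj cs⟩ w (t, e) =
      (w * t * w⁻¹, e + reflParity cs w t) := by
  unfold reflParity
  induction w using cs.simple_induction_left generalizing t e with
  | one => simp [Function.End.one_def]
  | mul_simple_left w i ih =>
    have h1 : (cs.lift ⟨signedConj cs, isLiftable_signedConj cs⟩ w (t, 0)).1 = w * t * w⁻¹ := by
      rw [ih]
    rw [map_mul, Function.End.mul_apply, Function.End.mul_apply, cs.lift_apply_simple, ih t e]
    generalize cs.lift ⟨signedConj cs, isLiftable_signedConj cs⟩ w (t, 0) = x at h1 ⊢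
    obtain ⟨a, b⟩ := x
    change a = _ at h1
    subst h1
    simp [signedConj, mul_assoc, add_assoc]

theorem reflParity_one (t : W) : reflParity cs 1 t = 0 := by
  simp [reflParity, Function.End.one_def]

open Classical in
theorem reflParity_simple (i : B) (t : W) :
    reflParity cs (cs.simple i) t = if t = cs.simple i then 1 else 0 := by
  rw [reflParity, cs.lift_apply_simple]
  simp [signedConj]

theorem reflParity_mul (u v t : W) :
    reflParity cs (u * v) t = reflParity cs v t + reflParity cs u (v * t * v⁻¹) := by
  conv_lhs => rw [reflParity]
  rw [map_mul, Function.End.mul_apply, lift_signedConj_apply, lift_signedConj_apply]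
  simp

/-- For t = usu⁻¹ the contributions of u and u⁻¹ cancel, because N(uu⁻¹, t) = 0. What remains is
N(s, s) = 1. -/
theorem reflParity_self {t : W} (ht : cs.IsReflection t) : reflParity cs t t = 1 := by
  obtain ⟨u, i, rfl⟩ := ht
  have h := reflParity_mul cs u u⁻¹ (u * cs.simple i * u⁻¹)
  rw [mul_inv_cancel, reflParity_one] at h
  rw [reflParity_mul, reflParity_mul]
  simp only [mul_assoc, inv_inv, inv_mul_cancel_left, inv_mul_cancel, mul_one, one_mul,
    cs.inv_simple, cs.simple_mul_simple_self, reflParity_simple, if_true] at h ⊢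
  linear_combination -h

theorem mem_rightInvSeq_of_reflParity_ne_zero (ω : List B) (t : W)
    (h : reflParity cs (cs.wordProd ω) t ≠ 0) : t ∈ cs.rightInvSeq ω := by
  induction ω with
  | nil => simp [reflParity_one] at h
  | cons i ω ih =>
    rw [CoxeterSystem.rightInvSeq, List.mem_cons]
    by_contra! hc
    rw [cs.wordProd_cons, reflParity_mul, reflParity_simple, if_neg, add_zero] at h
    · exact hc.2 (ih h)
    · intro h'
      apply hc.1
      rw [← h']
      group

theorem isRightInversion_of_reflParity_ne_zero {w t : W} (h : reflParity cs w t ≠ 0) :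
    cs.IsRightInversion w t := by
  obtain ⟨ω, hω, rfl⟩ := cs.exists_isReduced w
  exact cs.isRightInversion_of_mem_rightInvSeq hω (mem_rightInvSeq_of_reflParity_ne_zero cs ω t h)

/-- Nonzero parity forces an inversion. Since N(wt, t) = 1 + N(w, t), one of w and wt always has
nonzero parity, which gives the converse. This turns length comparisons into cocycle computations.
-/
theorem length_lt_mul_iff_reflParity {t : W} (ht : cs.IsReflection t) (w : W) :
    cs.length w < cs.length (w * t) ↔ reflParity cs w t = 0 := by
  constructor
  · intro h
    by_contra h0
    exact absurd (isRightInversion_of_reflParity_ne_zero cs h0).2 (by omega)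
  · intro h
    have h1 : reflParity cs (w * t) t ≠ 0 := by
      rw [reflParity_mul, reflParity_self cs ht, ht.inv, ht.mul_self, one_mul, h]
      simp
    have := (isRightInversion_of_reflParity_ne_zero cs h1).2
    rwa [mul_assoc, ht.mul_self, mul_one] at this

/-- Generators in J change the sign only at elements of W_J, and conjugation by W_J never brings t
into W_J. -/
theorem reflParity_eq_zero_of_mem_parabolic {J : Set B} {p t : W} (hp : p ∈ parabolic cs J)
    (ht : t ∉ parabolic cs J) : reflParity cs p t = 0 := by
  induction hp using Subgroup.closure_induction generalizing t with
  | mem x hx =>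
    obtain ⟨i, hi, rfl⟩ := hx
    rw [reflParity_simple, if_neg]
    rintro rfl
    exact ht (Subgroup.subset_closure ⟨i, hi, rfl⟩)
  | one => exact reflParity_one cs t
  | mul x y hx hy ihx ihy =>
    rw [reflParity_mul, ihy ht, ihx, add_zero]
    intro h
    apply ht
    have := mul_mem (mul_mem (inv_mem hy) h) hy
    simpa [parabolic, mul_assoc] using this
  | inv x hx ih =>
    have h := reflParity_mul cs x x⁻¹ t
    rw [mul_inv_cancel, reflParity_one, inv_inv, ih, add_zero] at h
    · exact h.symm
    · intro h
      apply ht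
      have := mul_mem (mul_mem hx h) (inv_mem hx)
      simpa [parabolic, mul_assoc] using this

/-- Remove a right descent s of p, which must lie in W_J. With r = psp⁻¹ in W_J, minimality of a
gives N(a, r) = 0, so N(ap, s) = N(p, s) ≠ 0 and s is also a descent of ap. -/
theorem bruhatLT_mul_parabolic {J : Set B} {a : W} (ha : IsMinRep cs J a) (p : W)
    (hp : p ∈ parabolic cs J) : p = 1 ∨ CoxBruhatLT cs a (a * p) := by
  induction h : cs.length p using Nat.strong_induction_on generalizing p with
  | _ n ih =>
    refine or_iff_not_imp_left.2 fun hp1 => ?_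
    obtain ⟨i, hi⟩ := cs.exists_rightDescent_of_ne_one hp1
    have hs := cs.isReflection_simple i
    have hpar : reflParity cs p (cs.simple i) ≠ 0 := fun h0 =>
      absurd ((length_lt_mul_iff_reflParity cs hs p).2 h0)
        (by have : cs.length (p * cs.simple i) < cs.length p := hi; omega)
    have hiJ : cs.simple i ∈ parabolic cs J := by
      by_contra hc
      exact hpar (reflParity_eq_zero_of_mem_parabolic cs hp hc)
    set r := p * cs.simple i * p⁻¹ with hr
    have hrJ : r ∈ parabolic cs J := mul_mem (mul_mem hp hiJ) (inv_mem hp)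
    have hrefl : cs.IsReflection r := hs.conj p
    have har : reflParity cs a r = 0 := by
      rw [← length_lt_mul_iff_reflParity cs hrefl]
      exact lt_of_le_of_ne (ha r hrJ) (hrefl.length_mul_left_ne a).symm
    have hstep : cs.length (a * p * cs.simple i) < cs.length (a * p) := by
      refine (isRightInversion_of_reflParity_ne_zero cs ?_).2
      rw [reflParity_mul, ← hr, har, add_zero]
      exact hpar
    have hlast : CoxBruhatLT cs (a * (p * cs.simple i)) (a * p) :=
      Relation.TransGen.single ⟨by rwa [← mul_assoc], cs.simple i, hs, by simp [mul_assoc]⟩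
    rcases ih _ (h ▸ hi) (p * cs.simple i) (mul_mem hp hiJ) rfl with h1 | h1
    · rwa [h1, mul_one] at hlast
    · exact h1.trans hlast

theorem exists_isMinRep (J : Set B) (u : W) :
    ∃ p ∈ parabolic cs J, IsMinRep cs J (u * p) := by
  classical
  obtain ⟨p, hp, hmin⟩ := exists_minimalFor_of_wellFoundedLT (· ∈ parabolic cs J)
    (fun p => cs.length (u * p)) ⟨1, one_mem _⟩
  refine ⟨p, hp, fun q hq => ?_⟩
  by_contra! h
  have := hmin (mul_mem hp hq) (by simpa [mul_assoc] using h.le)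
  simp only [mul_assoc] at this h
  omega

/-- The numbering only compares minimal representatives, so u < ut has to be moved to these. Right
translation by an element of W_J preserves the inequality because t is outside W_J. -/
theorem numbering_lt_of_length_lt {J : Set B} {n : ℕ} {f : W ⧸ parabolic cs J ≃ Fin n}
    (hf : IsBruhatNumbering cs J f) {u t : W} (ht : cs.IsReflection t)
    (hlt : cs.length u < cs.length (u * t))
    (hne : (QuotientGroup.mk u : W ⧸ parabolic cs J) ≠ QuotientGroup.mk (u * t)) :
    f (QuotientGroup.mk u) < f (QuotientGroup.mk (u * t)) := by
  have htJ : t ∉ parabolic cs J := fun h => hne (QuotientGroup.eq.2 (by simpa using h))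
  -- `u * t * p` is minimal in the upper coset, whereas `u * p` need not be minimal in the lower
  -- one; `q` corrects this.
  obtain ⟨p, hp, hb⟩ := exists_isMinRep cs J (u * t)
  obtain ⟨q, hq, ha⟩ := exists_isMinRep cs J (u * p)
  have hrefl : cs.IsReflection (p⁻¹ * t * p) := by simpa using ht.conj p⁻¹
  have hmid : CoxBruhatLT cs (u * p) (u * t * p) := by
    refine Relation.TransGen.single ⟨?_, _, hrefl, by group⟩
    have : u * t * p = u * p * (p⁻¹ * t * p) := by group
    rw [this, length_lt_mul_iff_reflParity cs hrefl, reflParity_mul,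
      reflParity_eq_zero_of_mem_parabolic cs hp]
    · rw [length_lt_mul_iff_reflParity cs ht] at hlt
      rw [show p * (p⁻¹ * t * p) * p⁻¹ = t by group, hlt, zero_add]
    · intro h
      apply htJ
      have := mul_mem (mul_mem hp h) (inv_mem hp)
      simpa [mul_assoc] using this
  have hlow : CoxBruhatLT cs (u * p * q) (u * t * p) := by
    rcases bruhatLT_mul_parabolic cs ha q⁻¹ (inv_mem hq) with h | h
    · rw [inv_eq_one.1 h, mul_one]
      exact hmid
    · exact Relation.TransGen.trans (by rwa [mul_inv_cancel_right] at h) hmid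
  have h := hf _ _ ha hb hlow
  have e1 : (QuotientGroup.mk (u * p * q) : W ⧸ parabolic cs J) = QuotientGroup.mk u :=
    QuotientGroup.eq.2 (by
      have := mul_mem (inv_mem hq) (inv_mem hp)
      simpa [mul_assoc] using this)
  have e2 : (QuotientGroup.mk (u * t * p) : W ⧸ parabolic cs J) = QuotientGroup.mk (u * t) :=
    QuotientGroup.eq.2 (by simpa [mul_assoc] using inv_mem hp)
  rwa [e1, e2] at h

theorem length_lt_of_bruhatLT {u v : W} (h : CoxBruhatLT cs u v) :
    cs.length u < cs.length v := by
  induction h with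
  | single h => exact h.1
  | tail _ h ih => exact ih.trans h.1

/-- Bruhat order increases length, so sorting the cosets by minimal length, with ties broken
arbitrarily, is a refinement. -/
theorem exists_isBruhatNumbering [Finite W] (J : Set B) :
    ∃ f : W ⧸ parabolic cs J ≃ Fin (parabolic cs J).index, IsBruhatNumbering cs J f := by
  classical
  let L : W ⧸ parabolic cs J → ℕ := fun x =>
    sInf {k | ∃ u : W, QuotientGroup.mk u = x ∧ cs.length u = k}
  have hL : ∀ u, IsMinRep cs J u → L (QuotientGroup.mk u) = cs.length u := by
    intro u hu
    refine le_antisymm (Nat.sInf_le ⟨u, rfl, rfl⟩) (le_csInf ⟨_, u, rfl, rfl⟩ ?_)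
    rintro _ ⟨v, hv, rfl⟩
    have := hu _ (QuotientGroup.eq.1 hv.symm)
    simpa using this
  have e : W ⧸ parabolic cs J ≃ Fin (parabolic cs J).index := Finite.equivFin _
  let g := L ∘ e.symm
  refine ⟨e.trans (Tuple.sort g).symm, fun u v hu hv huv => ?_⟩
  have hlen := length_lt_of_bruhatLT cs huv
  by_contra! hle
  have hmono := Tuple.monotone_sort g hle
  simp only [g, Function.comp_apply, Equiv.trans_apply, Equiv.apply_symm_apply,
    Equiv.symm_apply_apply, hL u hu, hL v hv] at hmono
  omega

end ReflectionCocycle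

/-! ### Inversions, length and Bruhat order in the symmetric group. -/

section PermutationLength

variable {n : ℕ}

/-- The inversions of a permutation, as ordered pairs of positions. -/
def inversionPairs (σ : Perm (Fin n)) : Finset (Fin n × Fin n) :=
  Finset.univ.filter fun p => p.1 < p.2 ∧ σ p.2 < σ p.1

theorem mem_inversionPairs {σ : Perm (Fin n)} {p : Fin n × Fin n} :
    p ∈ inversionPairs σ ↔ p.1 < p.2 ∧ σ p.2 < σ p.1 := by
  simp [inversionPairs]

theorem card_inversionPairs_lt_mul_swap {σ : Perm (Fin n)} {i j : Fin n} (hij : i < j)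
    (hσ : σ i < σ j) :
    (inversionPairs σ).card < (inversionPairs (σ * swap i j)).card := by
  -- An injection of the inversions of `σ` into those of `σ * swap i j` that misses `(i, j)`:
  -- transport a pair by the swap if this keeps its order, and leave it alone otherwise.
  let g : Fin n × Fin n → Fin n × Fin n := fun p =>
    if swap i j p.1 < swap i j p.2 then (swap i j p.1, swap i j p.2) else p
  have hg : ∀ p ∈ inversionPairs σ,
      g p ∈ inversionPairs (σ * swap i j) ∧ g p ≠ (i, j) := by
    rintro ⟨a, b⟩ hp
    rw [mem_inversionPairs] at hp ⊢
    simp only [g, Perm.mul_apply] at hp ⊢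
    split_ifs with h
    · refine ⟨⟨h, by simpa using hp.2⟩, fun he => ?_⟩
      rw [Prod.mk.injEq] at he
      have ha := (swap i j).injective (he.1.trans (swap_apply_right i j).symm)
      have hb := (swap i j).injective (he.2.trans (swap_apply_left i j).symm)
      subst ha hb
      exact absurd hp.1 (not_lt.2 hij.le)
    · refine ⟨⟨hp.1, ?_⟩, fun he => ?_⟩
      · simp only [swap_apply_def] at h ⊢
        grind
      · rw [Prod.mk.injEq] at he
        obtain ⟨rfl, rfl⟩ := he
        exact absurd hp.2 (not_lt.2 hσ.le)
  have hinj : Set.InjOn g (inversionPairs σ) := by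
    rintro ⟨a, b⟩ hp ⟨c, d⟩ hq h
    have hp' := (mem_inversionPairs.1 hp).1
    have hq' := (mem_inversionPairs.1 hq).1
    simp only [g] at h hp' hq'
    split_ifs at h with h1 h2 h2
    · simpa using h
    · simp only [Prod.mk.injEq] at h
      obtain ⟨rfl, rfl⟩ := h
      simp only [swap_apply_self] at h2
      exact absurd hp' h2
    · simp only [Prod.mk.injEq] at h
      obtain ⟨rfl, rfl⟩ := h
      simp only [swap_apply_self] at h1
      exact absurd hq' h1
    · exact h
  rw [← Finset.card_image_of_injOn hinj]
  refine Finset.card_lt_card ((Finset.ssubset_iff_of_subset ?_).2 ⟨(i, j), ?_, ?_⟩)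
  · intro q hq
    obtain ⟨p, hp, rfl⟩ := Finset.mem_image.1 hq
    exact (hg p hp).1
  · rw [mem_inversionPairs]
    simpa [hij] using hσ
  · intro hq
    obtain ⟨p, hp, h⟩ := Finset.mem_image.1 hq
    exact (hg p hp).2 h

/-- An adjacent swap reverses the order of no pair of positions but `(i, j)`. -/
theorem card_inversionPairs_mul_adjSwap_le (σ : Perm (Fin n)) {s : Perm (Fin n)}
    (hs : s ∈ adjSwaps n) :
    (inversionPairs (σ * s)).card ≤ (inversionPairs σ).card + 1 := by
  obtain ⟨i, j, hij, rfl⟩ := hs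
  rw [← Finset.card_image_of_injective (inversionPairs σ)
    ((swap i j).injective.prodMap (swap i j).injective)]
  refine (Finset.card_le_card ?_).trans (Finset.card_insert_le (i, j) _)
  rintro ⟨a, b⟩ hp
  rw [mem_inversionPairs] at hp
  simp only [Perm.mul_apply] at hp
  rw [Finset.mem_insert, Finset.mem_image, or_iff_not_imp_left]
  intro hne
  refine ⟨(swap i j a, swap i j b), mem_inversionPairs.2 ⟨?_, hp.2⟩, by simp⟩
  rw [Prod.mk.injEq] at hne
  have hab := hp.1
  simp only [swap_apply_def]
  clear hp
  split_ifs <;> grind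

theorem eq_one_of_forall_adj_lt {σ : Perm (Fin n)}
    (h : ∀ i j : Fin n, (i : ℕ) + 1 = j → σ i < σ j) : σ = 1 := by
  rcases n with _ | n
  · exact Subsingleton.elim _ _
  · have hmono : StrictMono σ := Fin.strictMono_iff_lt_succ.2 fun i => h _ _ (by simp)
    have := (StrictMono.range_inj hmono strictMono_id).1 (by simp [σ.surjective.range_eq])
    exact Equiv.ext fun x => congrFun this x

/-- Bubble sort: swapping an adjacent descent removes exactly one inversion. -/
theorem exists_adjSwaps_prod (σ : Perm (Fin n)) :
    ∃ l : List (Perm (Fin n)), (∀ s ∈ l, s ∈ adjSwaps n) ∧ l.prod = σ ∧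
      l.length = (inversionPairs σ).card := by
  induction h : (inversionPairs σ).card using Nat.strong_induction_on generalizing σ with
  | _ k ih =>
    subst h
    by_cases hσ : ∀ i j : Fin n, (i : ℕ) + 1 = j → σ i < σ j
    · obtain rfl := eq_one_of_forall_adj_lt hσ
      refine ⟨[], by simp, by simp, ?_⟩
      rw [List.length_nil, eq_comm, Finset.card_eq_zero, Finset.eq_empty_iff_forall_notMem]
      intro p hp
      rw [mem_inversionPairs] at hp
      exact absurd hp.1 (not_lt.2 hp.2.le)
    · push Not at hσ
      obtain ⟨i, j, hij, hle⟩ := hσ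
      have hlt : i < j := by rw [Fin.lt_def]; omega
      have hs : swap i j ∈ adjSwaps n := ⟨i, j, hij, rfl⟩
      have h1 : (inversionPairs (σ * swap i j)).card < (inversionPairs σ).card := by
        have := card_inversionPairs_lt_mul_swap (σ := σ * swap i j) hlt
          (by simpa using lt_of_le_of_ne hle (σ.injective.ne hlt.ne'))
        simpa [mul_assoc] using this
      have h2 : (inversionPairs σ).card ≤ (inversionPairs (σ * swap i j)).card + 1 := by
        simpa [mul_assoc] using card_inversionPairs_mul_adjSwap_le (σ * swap i j) hs
      obtain ⟨l, hl, hprod, hlen⟩ := ih _ h1 _ rfl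
      refine ⟨l ++ [swap i j], ?_, by simp [hprod, mul_assoc], ?_⟩
      · intro s hs'
        rcases List.mem_append.1 hs' with h | h
        · exact hl s h
        · rwa [List.mem_singleton.1 h]
      · rw [List.length_append, hlen, List.length_singleton]
        omega

theorem card_inversionPairs_prod_le (l : List (Perm (Fin n))) (hl : ∀ s ∈ l, s ∈ adjSwaps n) :
    (inversionPairs l.prod).card ≤ l.length := by
  induction l using List.reverseRecOn with
  | nil =>
    rw [List.prod_nil, List.length_nil, Nat.le_zero, Finset.card_eq_zero,
      Finset.eq_empty_iff_forall_notMem]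
    intro p hp
    rw [mem_inversionPairs] at hp
    exact absurd hp.1 (not_lt.2 hp.2.le)
  | append_singleton l s ih =>
    have h1 := ih fun t ht => hl t (by simp [ht])
    have h2 := card_inversionPairs_mul_adjSwap_le l.prod (hl s (by simp))
    rw [List.prod_append, List.prod_singleton, List.length_append, List.length_singleton]
    omega

theorem symLength_eq_card_inversionPairs (σ : Perm (Fin n)) :
    symLength σ = (inversionPairs σ).card := by
  obtain ⟨l, hl, hprod, hlen⟩ := exists_adjSwaps_prod σ
  refine le_antisymm (Nat.sInf_le ⟨l, hl, hprod, hlen⟩)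
    (le_csInf ⟨_, l, hl, hprod, hlen⟩ ?_)
  rintro k ⟨l', hl', rfl, rfl⟩
  exact card_inversionPairs_prod_le l' hl'

theorem symBruhatLT_mul_swap {σ : Perm (Fin n)} {i j : Fin n} (hij : i < j) (hσ : σ i < σ j) :
    SymBruhatLT σ (σ * swap i j) := by
  refine Relation.TransGen.single ⟨?_, swap i j, ⟨i, j, hij.ne, rfl⟩, rfl⟩
  rw [symLength_eq_card_inversionPairs, symLength_eq_card_inversionPairs]
  exact card_inversionPairs_lt_mul_swap hij hσ

/-- If an involution only moves ascents of `σ`, then multiplying by it goes up in Bruhat order. -/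
theorem symBruhatLT_mul_involution (σ π : Perm (Fin n)) (hπ : ∀ i, π (π i) = i) (hne : π ≠ 1)
    (hσ : ∀ i, i < π i → σ i < σ (π i)) : SymBruhatLT σ (σ * π) := by
  induction h : π.support.card using Nat.strong_induction_on generalizing σ π with
  | _ k ih =>
    subst h
    obtain ⟨i, hi⟩ : ∃ i, i < π i := by
      by_contra! hc
      refine hne (Equiv.ext fun x => le_antisymm (hc x) ?_)
      simpa [hπ] using hc (π x)
    have hfirst := symBruhatLT_mul_swap hi (hσ i hi)
    by_cases h1 : swap i (π i) * π = 1
    · have : π = swap i (π i) := by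
        rw [← inv_eq_iff_mul_eq_one, swap_inv] at h1
        exact h1.symm
      rwa [← this] at hfirst
    -- After one transposition is split off, the remaining involution fixes `i` and `π i` and agrees
    -- with `π` elsewhere. On the points that still move, `σ * swap i (π i)` agrees with `σ`, so the
    -- ascent condition survives.
    have key : ∀ x, (swap i (π i) * π) x = if x = i ∨ x = π i then x else π x := by
      intro x
      have := hπ i
      have := hπ x
      simp only [Perm.mul_apply, swap_apply_def]
      grind
    have hlast := ih _ (Perm.card_support_swap_mul hi.ne') (σ * swap i (π i))
      (swap i (π i) * π) ?_ h1 ?_ rfl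
    · rw [mul_assoc, ← mul_assoc (swap i (π i)), swap_mul_self, one_mul] at hlast
      exact hfirst.trans hlast
    · intro x
      have := hπ i
      have := hπ x
      simp only [key]
      grind
    · intro x hx
      have := hπ i
      have := hπ x
      have := hσ x
      simp only [key] at hx ⊢
      simp only [Perm.mul_apply, swap_apply_def]
      grind

/-- The cycle factors of an involution are the transpositions of the pairs that it exchanges. -/
theorem exists_swap_of_mem_cycleFactorsFinset {π t : Perm (Fin n)} (hπ : ∀ i, π (π i) = i)
    (ht : t ∈ π.cycleFactorsFinset) : ∃ i, i < π i ∧ t = swap i (π i) := by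
  rw [Perm.mem_cycleFactorsFinset_iff] at ht
  obtain ⟨hc, hs⟩ := ht
  have hsupp : ∀ x ∈ t.support, π x ∈ t.support := fun x hx => by
    rw [← hs x hx]
    exact Perm.apply_mem_support.2 hx
  have main : ∀ x ∈ t.support, t = swap x (π x) := by
    intro x hx
    have htx : t (t x) = x := by rw [hs _ (Perm.apply_mem_support.2 hx), hs x hx, hπ]
    have := hc.eq_swap_of_apply_apply_eq_self (Perm.mem_support.1 hx) htx
    rwa [← hs x hx]
  obtain ⟨x, hx⟩ := hc.nonempty_support
  have hne : π x ≠ x := by rw [← hs x hx]; exact Perm.mem_support.1 hx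
  rcases lt_or_gt_of_ne hne with h | h
  · exact ⟨π x, by rwa [hπ], main _ (hsupp x hx)⟩
  · exact ⟨x, h, main x hx⟩

end PermutationLength

/-! ### The coset representation is a strong E-embedding. -/

section CosetRepresentation

variable {B W : Type*} [Group W] {M : CoxeterMatrix B} (cs : CoxeterSystem M W) {J : Set B}
  {n : ℕ} {f : W ⧸ parabolic cs J ≃ Fin n}

theorem cosetPerm_apply {P : Subgroup W} (f : W ⧸ P ≃ Fin n) (w : W) (i : Fin n) :
    cosetPerm f w i = f (w • f.symm i) :=
  rfl

/-- The kernel of the action on the cosets is the normal core. -/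
theorem cosetPerm_injective (hJ : (parabolic cs J).normalCore = ⊥) :
    Function.Injective (cosetPerm f) := by
  refine (f.permCongrHom).injective.comp ?_
  rw [← MonoidHom.ker_eq_bot_iff, ← Subgroup.normalCore_eq_ker, hJ]

theorem cosetPerm_simple_simple (i : B) (k : Fin n) :
    cosetPerm f (cs.simple i) (cosetPerm f (cs.simple i) k) = k := by
  rw [← Perm.mul_apply, ← map_mul, cs.simple_mul_simple_self, map_one, Perm.one_apply]

/-- If `w < w s` then the permutation of `w` is increasing on the pairs exchanged by `s`. -/
theorem cosetPerm_lt_of_length_lt (hf : IsBruhatNumbering cs J f) {w : W} {i : B}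
    (hw : cs.length w < cs.length (w * cs.simple i)) (k : Fin n)
    (hk : k < cosetPerm f (cs.simple i) k) :
    cosetPerm f w k < cosetPerm f w (cosetPerm f (cs.simple i) k) := by
  have hs := cs.isReflection_simple i
  obtain ⟨x, rfl⟩ := f.surjective k
  obtain ⟨u, rfl⟩ := QuotientGroup.mk_surjective x
  simp only [cosetPerm_apply, Equiv.symm_apply_apply, MulAction.Quotient.smul_mk, smul_eq_mul]
    at hk ⊢
  -- Left multiplication of u by s becomes right multiplication by the reflection t. The order of
  -- the two numbers then forces u < ut.
  set t := u⁻¹ * cs.simple i * u with ht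
  have htr : cs.IsReflection t := by simpa using hs.conj u⁻¹
  have e1 : cs.simple i * u = u * t := by rw [ht]; group
  have hut : cs.length u < cs.length (u * t) := by
    refine lt_of_le_of_ne ?_ (htr.length_mul_left_ne u).symm
    by_contra! hlt
    have hu : u = u * t * t := by rw [mul_assoc, htr.mul_self, mul_one]
    have := numbering_lt_of_length_lt cs hf htr (u := u * t) (by rwa [← hu])
      (by rw [← hu, ← e1]; intro h; rw [h] at hk; exact lt_irrefl _ hk)
    rw [← hu, ← e1] at this
    exact lt_asymm this hk
  rw [e1, ← mul_assoc]
  refine numbering_lt_of_length_lt cs hf htr ?_ ?_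
  -- N(wu, t) = N(u, t) + N(w, s), and both terms vanish.
  · rw [length_lt_mul_iff_reflParity cs htr] at hut ⊢
    rw [reflParity_mul, hut, zero_add, show u * t * u⁻¹ = cs.simple i by rw [ht]; group]
    exact (length_lt_mul_iff_reflParity cs hs w).1 hw
  · intro h
    have h' := congrArg (fun y => w⁻¹ • y) h
    simp only [MulAction.Quotient.smul_mk, smul_eq_mul, mul_assoc, inv_mul_cancel_left] at h'
    rw [e1, ← h'] at hk
    exact lt_irrefl _ hk

theorem length_lt_of_weakLT {u v : W} (h : WeakLT cs u v) : cs.length u < cs.length v := by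
  induction h with
  | single h => omega
  | tail _ h ih => omega

theorem isStrongEEmbedding_cosetPerm (hJ : (parabolic cs J).normalCore = ⊥)
    (hf : IsBruhatNumbering cs J f) : IsStrongEEmbedding cs (cosetPerm f) := by
  refine ⟨cosetPerm_injective cs hJ, fun w i hw t ht => ?_⟩
  obtain ⟨k, hk, rfl⟩ :=
    exists_swap_of_mem_cycleFactorsFinset (cosetPerm_simple_simple cs i) ht
  exact symBruhatLT_mul_swap hk
    (cosetPerm_lt_of_length_lt cs hf (length_lt_of_weakLT cs hw) k hk)

theorem isEEmbedding_cosetPerm (hJ : (parabolic cs J).normalCore = ⊥)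
    (hf : IsBruhatNumbering cs J f) : IsEEmbedding cs (cosetPerm f) := by
  refine ⟨cosetPerm_injective cs hJ, fun u v huv => ?_⟩
  refine Relation.TransGen.lift' (cosetPerm f) ?_ u v huv
  rintro a b ⟨hlen, i, rfl⟩
  change SymBruhatLT _ _
  rw [map_mul]
  refine symBruhatLT_mul_involution _ _ (cosetPerm_simple_simple cs i) ?_
    (cosetPerm_lt_of_length_lt cs hf (by omega))
  rw [← map_one (cosetPerm f), (cosetPerm_injective cs hJ).ne_iff]
  intro h
  rw [h, mul_one] at hlen
  omega

end CosetRepresentation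

/-! ### Upward and rightward quarter planes. -/

section Cones

/-- `q` lies in the upward quarter plane with apex `p`. -/
def ConeAbove (p q : ℝ × ℝ) : Prop :=
  |q.1 - p.1| ≤ q.2 - p.2

/-- `q` lies in the rightward quarter plane with apex `p`. -/
def ConeRight (p q : ℝ × ℝ) : Prop :=
  |q.2 - p.2| ≤ q.1 - p.1

theorem ConeAbove.refl (p : ℝ × ℝ) : ConeAbove p p := by simp [ConeAbove]

theorem ConeAbove.trans {p q r : ℝ × ℝ} (h : ConeAbove p q) (h' : ConeAbove q r) :
    ConeAbove p r := by
  simp only [ConeAbove, abs_le] at *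
  constructor <;> linarith [h.1, h.2, h'.1, h'.2]

theorem ConeRight.refl (p : ℝ × ℝ) : ConeRight p p := by simp [ConeRight]

theorem ConeRight.trans {p q r : ℝ × ℝ} (h : ConeRight p q) (h' : ConeRight q r) :
    ConeRight p r := by
  simp only [ConeRight, abs_le] at *
  constructor <;> linarith [h.1, h.2, h'.1, h'.2]

theorem ConeAbove.snd_le {p q : ℝ × ℝ} (h : ConeAbove p q) : p.2 ≤ q.2 := by
  have := (abs_nonneg _).trans h
  linarith

theorem mem_segment_iff_coords {a b p : ℝ × ℝ} :
    p ∈ segment ℝ a b ↔ ∃ r : ℝ, 0 ≤ r ∧ r ≤ 1 ∧ p.1 = a.1 + r * (b.1 - a.1) ∧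
      p.2 = a.2 + r * (b.2 - a.2) := by
  rw [segment_eq_image', Set.mem_image]
  constructor
  · rintro ⟨r, ⟨h0, h1⟩, rfl⟩
    exact ⟨r, h0, h1, by simp, by simp⟩
  · rintro ⟨r, h0, h1, h2, h3⟩
    exact ⟨r, ⟨h0, h1⟩, Prod.ext (by simp [h2]) (by simp [h3])⟩

theorem ConeAbove.of_mem_segment {a b p : ℝ × ℝ} (h : ConeAbove a b) (hp : p ∈ segment ℝ a b) :
    ConeAbove a p ∧ ConeAbove p b := by
  obtain ⟨r, h0, h1, hx, hy⟩ := mem_segment_iff_coords.1 hp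
  simp only [ConeAbove, abs_le] at h ⊢
  rw [hx, hy]
  refine ⟨⟨?_, ?_⟩, ?_, ?_⟩ <;> nlinarith [h.1, h.2]

theorem coneAbove_or_of_mem_segment {a b p q : ℝ × ℝ} (h : ConeAbove a b)
    (hp : p ∈ segment ℝ a b) (hq : q ∈ segment ℝ a b) : ConeAbove p q ∨ ConeAbove q p := by
  obtain ⟨r, h0, h1, hx, hy⟩ := mem_segment_iff_coords.1 hp
  obtain ⟨r', h0', h1', hx', hy'⟩ := mem_segment_iff_coords.1 hq
  simp only [ConeAbove, abs_le] at h ⊢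
  rw [hx, hy, hx', hy']
  rcases le_total r r' with hr | hr
  · left
    constructor <;> nlinarith [h.1, h.2]
  · right
    constructor <;> nlinarith [h.1, h.2]

end Cones

/-! ### Geometry of borders and of the tiles of a single step. -/

section Borders

variable {n : ℕ} {θ : Fin n → ℝ}

theorem abs_sin_le_cos {x : ℝ} (hx : x ∈ Set.Ioo (-(Real.pi / 4)) (Real.pi / 4)) :
    |Real.sin x| ≤ Real.cos x := by
  obtain ⟨h1, h2⟩ := hx
  have hpi := Real.pi_pos
  have ha : 0 < Real.sin (x + Real.pi / 4) := Real.sin_pos_of_pos_of_lt_pi (by linarith)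
    (by linarith)
  have hb : 0 < Real.sin (Real.pi / 4 - x) := Real.sin_pos_of_pos_of_lt_pi (by linarith)
    (by linarith)
  rw [Real.sin_add, Real.sin_pi_div_four, Real.cos_pi_div_four] at ha
  rw [Real.sin_sub, Real.sin_pi_div_four, Real.cos_pi_div_four] at hb
  have h2 : (0 : ℝ) < √2 / 2 := by positivity
  rw [abs_le]
  constructor
  · have : 0 < (Real.sin x + Real.cos x) * (√2 / 2) := by linarith
    have := (mul_pos_iff_of_pos_right h2).1 this
    linarith
  · have : 0 < (Real.cos x - Real.sin x) * (√2 / 2) := by linarith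
    have := (mul_pos_iff_of_pos_right h2).1 this
    linarith

/-- Both sin + cos = √2 sin(· + π/4) and sin − cos = √2 sin(· − π/4) are strictly increasing on
(−π/4, π/4). -/
theorem abs_cos_sub_lt_sin_sub {x y : ℝ} (hx : x ∈ Set.Ioo (-(Real.pi / 4)) (Real.pi / 4))
    (hy : y ∈ Set.Ioo (-(Real.pi / 4)) (Real.pi / 4)) (hxy : x < y) :
    |Real.cos y - Real.cos x| < Real.sin y - Real.sin x := by
  obtain ⟨h1, h2⟩ := hx
  obtain ⟨h3, h4⟩ := hy
  have ha : Real.sin (x + Real.pi / 4) < Real.sin (y + Real.pi / 4) :=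
    Real.sin_lt_sin_of_lt_of_le_pi_div_two (by linarith) (by linarith) (by linarith)
  have hb : Real.sin (x - Real.pi / 4) < Real.sin (y - Real.pi / 4) :=
    Real.sin_lt_sin_of_lt_of_le_pi_div_two (by linarith) (by linarith) (by linarith)
  rw [Real.sin_add, Real.sin_add, Real.sin_pi_div_four, Real.cos_pi_div_four] at ha
  rw [Real.sin_sub, Real.sin_sub, Real.sin_pi_div_four, Real.cos_pi_div_four] at hb
  have h2 : (0 : ℝ) < √2 / 2 := by positivity
  have ha' := lt_of_mul_lt_mul_right (a := √2 / 2)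
    (b := Real.sin x + Real.cos x) (c := Real.sin y + Real.cos y) (by linarith) h2.le
  have hb' := lt_of_mul_lt_mul_right (a := √2 / 2)
    (b := Real.sin x - Real.cos x) (c := Real.sin y - Real.cos y) (by linarith) h2.le
  rw [abs_lt]
  constructor <;> linarith

theorem vertex_zero (σ : Perm (Fin n)) : vertex θ σ 0 = 0 := by simp [vertex]

theorem vertex_last (σ τ : Perm (Fin n)) : vertex θ σ n = vertex θ τ n := by
  have h : ∀ ρ : Perm (Fin n), vertex θ ρ n = ∑ i, (Real.sin (θ i), Real.cos (θ i)) := by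
    intro ρ
    rw [vertex, Finset.filter_true_of_mem fun i _ => i.2]
    exact Equiv.sum_comp ρ fun i => (Real.sin (θ i), Real.cos (θ i))
  rw [h, h]

theorem vertex_succ (σ : Perm (Fin n)) {k : ℕ} (hk : k < n) :
    vertex θ σ (k + 1) =
      vertex θ σ k + (Real.sin (θ (σ ⟨k, hk⟩)), Real.cos (θ (σ ⟨k, hk⟩))) := by
  have : Finset.univ.filter (fun i : Fin n => i.val < k + 1) =
      insert ⟨k, hk⟩ (Finset.univ.filter fun i : Fin n => i.val < k) := by
    ext i
    simp only [Finset.mem_filter, Finset.mem_univ, true_and, Finset.mem_insert, Fin.ext_iff]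
    omega
  rw [vertex, this, Finset.sum_insert (by simp), add_comm, vertex]

theorem coneAbove_vertex_succ (hθ : IsLeftHalf θ) (σ : Perm (Fin n)) (k : ℕ) :
    ConeAbove (vertex θ σ k) (vertex θ σ (k + 1)) := by
  by_cases hk : k < n
  · rw [vertex_succ σ hk]
    simpa [ConeAbove] using abs_sin_le_cos (hθ.2 _)
  -- Beyond index `n` the vertices stay at the uppermost one.
  · have : vertex θ σ (k + 1) = vertex θ σ k := by
      unfold vertex
      congr 1
      ext i
      have := i.2
      simp only [Finset.mem_filter, Finset.mem_univ, true_and]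
      omega
    rw [this]
    exact .refl _

theorem coneAbove_vertex (hθ : IsLeftHalf θ) (σ : Perm (Fin n)) {k l : ℕ} (hkl : k ≤ l) :
    ConeAbove (vertex θ σ k) (vertex θ σ l) := by
  induction l, hkl using Nat.le_induction with
  | base => exact .refl _
  | succ l _ ih => exact ih.trans (coneAbove_vertex_succ hθ σ l)

theorem coneAbove_or_of_mem_chain (hθ : IsLeftHalf θ) {σ : Perm (Fin n)} {k l k' l' : ℕ}
    {p q : ℝ × ℝ} (hp : p ∈ chain θ σ k l) (hq : q ∈ chain θ σ k' l') :
    ConeAbove p q ∨ ConeAbove q p := by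
  obtain ⟨i, -, -, hpi⟩ := hp
  obtain ⟨j, -, -, hqj⟩ := hq
  have hi := (coneAbove_vertex_succ hθ σ i).of_mem_segment hpi
  have hj := (coneAbove_vertex_succ hθ σ j).of_mem_segment hqj
  rcases lt_trichotomy i j with h | rfl | h
  · exact .inl ((hi.2.trans (coneAbove_vertex hθ σ h)).trans hj.1)
  · exact coneAbove_or_of_mem_segment (coneAbove_vertex_succ hθ σ i) hpi hqj
  · exact .inr ((hj.2.trans (coneAbove_vertex hθ σ h)).trans hi.1)

/-- Borders are 1-Lipschitz over the vertical axis, since any two of their points are comparable for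
the upward cone. -/
theorem abs_fst_sub_le_of_mem_chain (hθ : IsLeftHalf θ) {σ : Perm (Fin n)} {k l k' l' : ℕ}
    {p q : ℝ × ℝ} (hp : p ∈ chain θ σ k l) (hq : q ∈ chain θ σ k' l') :
    |q.1 - p.1| ≤ |q.2 - p.2| := by
  rcases coneAbove_or_of_mem_chain hθ hp hq with h | h
  · exact le_trans h (le_abs_self _)
  · rw [abs_sub_comm, abs_sub_comm q.2]
    exact le_trans h (le_abs_self _)

/-- A border is a graph over the vertical axis. -/
theorem eq_of_mem_chain_of_snd_eq (hθ : IsLeftHalf θ) {σ : Perm (Fin n)} {k l k' l' : ℕ}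
    {p q : ℝ × ℝ} (hp : p ∈ chain θ σ k l) (hq : q ∈ chain θ σ k' l') (h : p.2 = q.2) :
    p = q := by
  have := abs_fst_sub_le_of_mem_chain hθ hp hq
  rw [h, sub_self, abs_zero] at this
  have := abs_eq_zero.1 (le_antisymm this (abs_nonneg _))
  exact Prod.ext (by linarith) h

theorem chain_subset_border {σ : Perm (Fin n)} {k l : ℕ} (hl : l ≤ n) :
    chain θ σ k l ⊆ border θ σ := by
  rintro p ⟨j, -, hj, hp⟩
  exact ⟨j, j.zero_le, hj.trans_le hl, hp⟩

theorem snd_mem_Icc_of_mem_chain (hθ : IsLeftHalf θ) {σ : Perm (Fin n)} {k l : ℕ} {p : ℝ × ℝ}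
    (hp : p ∈ chain θ σ k l) : (vertex θ σ k).2 ≤ p.2 ∧ p.2 ≤ (vertex θ σ l).2 := by
  obtain ⟨i, hki, hil, hpi⟩ := hp
  have hi := (coneAbove_vertex_succ hθ σ i).of_mem_segment hpi
  exact ⟨((coneAbove_vertex hθ σ hki).trans hi.1).snd_le,
    (hi.2.trans (coneAbove_vertex hθ σ hil)).snd_le⟩

theorem exists_mem_segment_snd_eq {a b : ℝ × ℝ} {y : ℝ} (ha : a.2 ≤ y) (hb : y ≤ b.2) :
    ∃ p ∈ segment ℝ a b, p.2 = y := by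
  have : y ∈ segment ℝ a.2 b.2 := by
    rw [segment_eq_Icc (ha.trans hb)]
    exact ⟨ha, hb⟩
  have himg := image_segment ℝ (LinearMap.snd ℝ ℝ ℝ).toAffineMap a b
  obtain ⟨p, hp, hpy⟩ : y ∈ (LinearMap.snd ℝ ℝ ℝ).toAffineMap '' segment ℝ a b := by
    rw [himg]
    exact this
  exact ⟨p, hp, hpy⟩

theorem exists_mem_chain_snd_eq (σ : Perm (Fin n)) {k l : ℕ} (hkl : k < l) {y : ℝ}
    (hk : (vertex θ σ k).2 ≤ y) (hl : y ≤ (vertex θ σ l).2) : ∃ p ∈ chain θ σ k l, p.2 = y := by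
  induction l, hkl using Nat.le_induction with
  | base =>
    obtain ⟨p, hp, hy⟩ := exists_mem_segment_snd_eq hk hl
    exact ⟨p, ⟨k, le_rfl, Nat.lt_succ_self k, hp⟩, hy⟩
  | succ l hkl ih =>
    rcases le_total y (vertex θ σ l).2 with h | h
    · obtain ⟨p, ⟨j, h1, h2, hp⟩, hy⟩ := ih h
      exact ⟨p, ⟨j, h1, h2.trans (Nat.lt_succ_self l), hp⟩, hy⟩
    · obtain ⟨p, hp, hy⟩ := exists_mem_segment_snd_eq h hl
      exact ⟨p, ⟨l, by omega, Nat.lt_succ_self l, hp⟩, hy⟩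

theorem mem_chain_of_mem_border (hθ : IsLeftHalf θ) {σ : Perm (Fin n)} {k l : ℕ} (hkl : k < l)
    {p : ℝ × ℝ} (hp : p ∈ border θ σ) (hk : (vertex θ σ k).2 ≤ p.2)
    (hl : p.2 ≤ (vertex θ σ l).2) : p ∈ chain θ σ k l := by
  obtain ⟨q, hq, hqy⟩ := exists_mem_chain_snd_eq σ hkl hk hl
  rwa [← eq_of_mem_chain_of_snd_eq hθ hq hp hqy]

theorem exists_mem_border_snd_eq (hθ : IsLeftHalf θ) {σ : Perm (Fin n)} (τ : Perm (Fin n))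
    {p : ℝ × ℝ} (hp : p ∈ border θ σ) : ∃ q ∈ border θ τ, q.2 = p.2 := by
  have hn : 0 < n := by
    obtain ⟨j, -, hj, -⟩ := hp
    omega
  have h := snd_mem_Icc_of_mem_chain hθ hp
  refine exists_mem_chain_snd_eq τ hn ?_ ?_
  · rw [vertex_zero] at h ⊢
    exact h.1
  · rw [vertex_last τ σ]
    exact h.2

/-- Each vertex of the border of `τ` lies in the rightward quarter plane of the corresponding
vertex of the border of `σ`. -/
def VertexwiseRight (θ : Fin n → ℝ) (σ τ : Perm (Fin n)) : Prop :=
  ∀ k, ConeRight (vertex θ σ k) (vertex θ τ k)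

/-- Vertices with the same index may have different heights, so they cannot be compared
horizontally. By interpolation, `b` is in the rightward cone of a point of the border of `σ`, and a
1-Lipschitz graph through the apex cannot pass to the right of `b` at the height of `b`. -/
theorem VertexwiseRight.leftOf (hθ : IsLeftHalf θ) {σ τ : Perm (Fin n)}
    (h : VertexwiseRight θ σ τ) : LeftOf (border θ σ) (border θ τ) := by
  rintro a ha b ⟨j, h0, hj, hb⟩ hab
  obtain ⟨r, hr0, hr1, hx, hy⟩ := mem_segment_iff_coords.1 hb
  set u := vertex θ σ j
  set v := vertex θ σ (j + 1)
  have hc : (u.1 + r * (v.1 - u.1), u.2 + r * (v.2 - u.2)) ∈ border θ σ :=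
    ⟨j, h0, hj, mem_segment_iff_coords.2 ⟨r, hr0, hr1, rfl, rfl⟩⟩
  have hl := abs_fst_sub_le_of_mem_chain hθ hc ha
  have hu := h j
  have hv := h (j + 1)
  have key : |b.2 - (u.2 + r * (v.2 - u.2))| ≤ b.1 - (u.1 + r * (v.1 - u.1)) := by
    simp only [ConeRight, abs_le] at hu hv ⊢
    rw [hx, hy]
    constructor <;> nlinarith [hu.1, hu.2, hv.1, hv.2]
  simp only at hl
  rw [hab] at hl
  have := (le_abs_self _).trans (hl.trans key)
  linarith

/-- Each vertex of the border of `τ` either coincides with the corresponding vertex of the border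
of `σ` or lies in the interior of its rightward quarter plane. -/
def StepRight (θ : Fin n → ℝ) (σ τ : Perm (Fin n)) : Prop :=
  ∀ k, vertex θ σ k = vertex θ τ k ∨
    |(vertex θ τ k).2 - (vertex θ σ k).2| < (vertex θ τ k).1 - (vertex θ σ k).1

theorem StepRight.vertexwiseRight {σ τ : Perm (Fin n)} (h : StepRight θ σ τ) :
    VertexwiseRight θ σ τ := by
  intro k
  rcases h k with h | h
  · rw [h]
    exact .refl _
  · exact le_of_lt h

/-- Among the first k positions, pairs exchanged by π cancel in the difference of the k-th vertices.
Each remaining position i has i < k ≤ π i, so it is an ascent and contributes a vector strictly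
inside the rightward cone. -/
theorem stepRight_mul_involution (hθ : IsLeftHalf θ) (σ π : Perm (Fin n))
    (hπ : ∀ i, π (π i) = i) (hσ : ∀ i, i < π i → σ i < σ (π i)) :
    StepRight θ σ (σ * π) := by
  intro k
  let g : Fin n → ℝ × ℝ := fun i => (Real.sin (θ (σ i)), Real.cos (θ (σ i)))
  let A := Finset.univ.filter fun i : Fin n => i.val < k
  let E := A.filter fun i => ¬ (π i).val < k
  have hsub : vertex θ (σ * π) k - vertex θ σ k = ∑ i ∈ E, (g (π i) - g i) := by
    have h1 : vertex θ (σ * π) k - vertex θ σ k = ∑ i ∈ A, (g (π i) - g i) := by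
      rw [Finset.sum_sub_distrib]
      rfl
    have h0 : ∑ i ∈ A.filter (fun i => (π i).val < k), (g (π i) - g i) = 0 := by
      rw [Finset.sum_sub_distrib, sub_eq_zero]
      refine Finset.sum_equiv π (fun i => ?_) fun i _ => rfl
      simp [A, hπ, and_comm]
    rw [h1, ← Finset.sum_filter_add_sum_filter_not A fun i => (π i).val < k, h0, zero_add]
  have hE : ∀ i ∈ E, |(g (π i) - g i).2| < (g (π i) - g i).1 := by
    intro i hi
    simp only [E, A, Finset.mem_filter, Finset.mem_univ, true_and] at hi
    have hlt : i < π i := by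
      rw [Fin.lt_def]
      omega
    exact abs_cos_sub_lt_sin_sub (hθ.2 _) (hθ.2 _) (hθ.1 (hσ i hlt))
  rcases E.eq_empty_or_nonempty with h | h
  · left
    rw [h, Finset.sum_empty, sub_eq_zero] at hsub
    exact hsub.symm
  · right
    rw [← Prod.snd_sub, ← Prod.fst_sub, hsub, Prod.snd_sum, Prod.fst_sum]
    exact (Finset.abs_sum_le_sum_abs _ _).trans_lt (Finset.sum_lt_sum_of_nonempty h hE)

/-- The left and right chains of a tile share exactly their end points. -/
theorem StepRight.chain_inter_chain (hθ : IsLeftHalf θ) {σ τ : Perm (Fin n)}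
    (h : StepRight θ σ τ) {k l : ℕ} (hkl : IsTileSpan θ σ τ k l) :
    chain θ σ k l ∩ chain θ τ k l = {vertex θ σ k, vertex θ σ l} := by
  obtain ⟨hlt, hln, hk, hl, hne⟩ := hkl
  have hstrict : ∀ j, k < j → j < l →
      |(vertex θ τ j).2 - (vertex θ σ j).2| < (vertex θ τ j).1 - (vertex θ σ j).1 :=
    fun j h1 h2 => (h j).resolve_left (hne j h1 h2)
  have hends : ∀ ρ : Perm (Fin n), vertex θ ρ k ∈ chain θ ρ k l ∧
      vertex θ ρ l ∈ chain θ ρ k l := fun ρ =>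
    ⟨⟨k, le_rfl, by omega, left_mem_segment _ _ _⟩, ⟨l - 1, by omega, by omega, by
      rw [Nat.sub_add_cancel (by omega)]
      exact right_mem_segment _ _ _⟩⟩
  refine Set.Subset.antisymm ?_ ?_
  · rintro p ⟨hpσ, j, hkj, hjl, hp⟩
    obtain ⟨r, hr0, hr1, hx, hy⟩ := mem_segment_iff_coords.1 hp
    set u := vertex θ σ j with hu'
    set v := vertex θ σ (j + 1) with hv'
    have hc : (u.1 + r * (v.1 - u.1), u.2 + r * (v.2 - u.2)) ∈ border θ σ :=
      ⟨j, j.zero_le, hjl.trans_le hln, mem_segment_iff_coords.2 ⟨r, hr0, hr1, rfl, rfl⟩⟩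
    have hlip := abs_fst_sub_le_of_mem_chain hθ hc hpσ
    simp only at hlip
    have hu := h.vertexwiseRight j
    have hv := h.vertexwiseRight (j + 1)
    simp only [ConeRight, abs_le] at hu hv
    -- By the Lipschitz bound, a point of the border of `σ` is never strictly inside the rightward
    -- cone of another one. Away from the two end points, interpolation gives a positive weight to a
    -- strictly displaced vertex, which contradicts this.
    have hnot : ¬ |p.2 - (u.2 + r * (v.2 - u.2))| < p.1 - (u.1 + r * (v.1 - u.1)) := by
      intro hlt'
      exact absurd (((le_abs_self _).trans hlip).trans_lt hlt') (lt_irrefl _)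
    rcases hkj.eq_or_lt with rfl | hkj
    · rcases hr0.eq_or_lt with rfl | hr0
      · left
        rw [hk]
        exact Prod.ext (by simpa using hx) (by simpa using hy)
      · have hs := hstrict (k + 1) (by omega) (by omega)
        rw [abs_lt] at hs
        refine absurd ?_ hnot
        rw [hx, hy, abs_lt]
        constructor <;> nlinarith [hs.1, hs.2, hu.1, hu.2]
    · have hs := hstrict j hkj hjl
      rw [abs_lt] at hs
      rcases hr1.eq_or_lt with rfl | hr1
      · rcases (show j + 1 ≤ l from hjl).eq_or_lt with rfl | hjl'
        · right
          rw [Set.mem_singleton_iff, hl]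
          exact Prod.ext (by simpa using hx) (by simpa using hy)
        · have hs' := hstrict (j + 1) (by omega) hjl'
          rw [abs_lt] at hs'
          refine absurd ?_ hnot
          rw [hx, hy, abs_lt]
          constructor <;> nlinarith [hs'.1, hs'.2]
      · refine absurd ?_ hnot
        rw [hx, hy, abs_lt]
        constructor <;> nlinarith [hs.1, hs.2, hv.1, hv.2]
  · rintro p (rfl | rfl)
    · exact ⟨(hends σ).1, hk ▸ (hends τ).1⟩
    · exact ⟨(hends σ).2, hl ▸ (hends τ).2⟩

theorem finite_stepTiles (σ τ : Perm (Fin n)) : (stepTiles θ σ τ).Finite := by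
  refine ((Set.finite_Iic n).image2 (fun k l => between (chain θ σ k l) (chain θ τ k l))
    (Set.finite_Iic n)).subset ?_
  rintro K ⟨k, l, h, rfl⟩
  exact ⟨k, le_trans (Nat.le_of_lt (Nat.lt_of_succ_lt h.1)) h.2.1, l, h.2.1, rfl⟩

/-- If `a` lies on the `j`-th edge, the tile runs from the last common vertex of index at most `j`
to the first one of larger index. -/
theorem StepRight.exists_tile_mem (hθ : IsLeftHalf θ) {σ τ : Perm (Fin n)} {a b p : ℝ × ℝ}
    (ha : a ∈ border θ σ) (hb : b ∈ border θ τ) (hap : a.2 = p.2) (hbp : b.2 = p.2)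
    (h1 : a.1 < p.1) (h2 : p.1 ≤ b.1) : ∃ K ∈ stepTiles θ σ τ, p ∈ K := by
  classical
  obtain ⟨j, -, hj, haj⟩ := ha
  have hseg := (coneAbove_vertex_succ hθ σ j).of_mem_segment haj
  have hex : ∃ l, j < l ∧ l ≤ n ∧ vertex θ σ l = vertex θ τ l :=
    ⟨n, hj, le_rfl, vertex_last σ τ⟩
  obtain ⟨l, hl⟩ : ∃ l, l = Nat.find hex := ⟨_, rfl⟩
  obtain ⟨hjl, hln, hVl⟩ := Nat.find_spec hex
  rw [← hl] at hjl hln hVl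
  set k := Nat.findGreatest (fun k => vertex θ σ k = vertex θ τ k) j with hk
  have hkj : k ≤ j := Nat.findGreatest_le j
  have hVk : vertex θ σ k = vertex θ τ k :=
    Nat.findGreatest_spec (P := fun k => vertex θ σ k = vertex θ τ k) (Nat.zero_le j)
      (by simp only [vertex_zero])
  have hlo : (vertex θ σ k).2 ≤ a.2 := ((coneAbove_vertex hθ σ hkj).trans hseg.1).snd_le
  have hhi : a.2 ≤ (vertex θ σ l).2 := (hseg.2.trans (coneAbove_vertex hθ σ hjl)).snd_le
  have hbc : b ∈ chain θ τ k l := by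
    refine mem_chain_of_mem_border hθ (hkj.trans_lt hjl) hb ?_ ?_
    · rwa [← hVk, hbp, ← hap]
    · rwa [← hVl, hbp, ← hap]
  refine ⟨_, ⟨k, l, ⟨?_, hln, hVk, hVl, fun i hi1 hi2 he => ?_⟩, rfl⟩,
    a, ⟨j, hkj, hjl, haj⟩, b, hbc, hap, hbp, h1.le, h2⟩
  -- If `l = k + 1`, the two borders share this edge, so `a = b`, leaving no room for `p` strictly
  -- to the right of `a`.
  · by_contra hc
    have hl1 : l = k + 1 := by omega
    have hbσ : b ∈ chain θ σ k l := by
      obtain ⟨i, hi1, hi2, hi⟩ := hbc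
      obtain rfl : i = k := by omega
      rw [hl1] at hVl
      exact ⟨k, hi1, hi2, by rwa [hVk, hVl]⟩
    have := eq_of_mem_chain_of_snd_eq hθ hbσ ⟨j, hkj, hjl, haj⟩ (hbp.trans hap.symm)
    rw [this] at h2
    exact absurd h2 (not_le.2 h1)
  · rcases le_or_gt i j with hij | hij
    · exact absurd (Nat.le_findGreatest hij he) (not_le.2 hi1)
    · exact Nat.find_min hex (hl ▸ hi2) ⟨hij, hi2.le.trans hln, he⟩

theorem exists_borders_of_mem_stepTiles {σ τ : Perm (Fin n)}
    {K : Set (ℝ × ℝ)} (hK : K ∈ stepTiles θ σ τ) {p : ℝ × ℝ} (hp : p ∈ K) :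
    ∃ a ∈ border θ σ, ∃ b ∈ border θ τ, a.2 = p.2 ∧ b.2 = p.2 ∧ a.1 ≤ p.1 ∧ p.1 ≤ b.1 := by
  obtain ⟨k, l, h, rfl⟩ := hK
  obtain ⟨a, ha, b, hb, h'⟩ := hp
  exact ⟨a, chain_subset_border h.2.1 ha, b, chain_subset_border h.2.1 hb, h'⟩

theorem exists_pos_add_mem_of_mem_interior {s : Set (ℝ × ℝ)} {p : ℝ × ℝ} (hp : p ∈ interior s)
    (v : ℝ × ℝ) : ∃ ε : ℝ, 0 < ε ∧ p + ε • v ∈ interior s := by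
  have hc : Filter.Tendsto (fun ε : ℝ => p + ε • v) (nhdsWithin 0 (Set.Ioi 0)) (nhds p) := by
    have : Continuous fun ε : ℝ => p + ε • v := by fun_prop
    have := this.tendsto 0
    rw [zero_smul, add_zero] at this
    exact this.mono_left nhdsWithin_le_nhds
  have := (hc.eventually (isOpen_interior.mem_nhds hp)).and self_mem_nhdsWithin
  obtain ⟨ε, h1, h2⟩ := this.exists
  exact ⟨ε, h2, h1⟩

/-- A common vertex cannot lie strictly inside a span, so different spans have index intervals that
do not overlap, and their tiles lie at different heights. Moving an interior point slightly upwards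
makes the comparison strict. -/
theorem disjoint_interior_of_mem_stepTiles (hθ : IsLeftHalf θ) {σ τ : Perm (Fin n)}
    {K K' : Set (ℝ × ℝ)} (hK : K ∈ stepTiles θ σ τ) (hK' : K' ∈ stepTiles θ σ τ)
    (hne : K ≠ K') : Disjoint (interior K) (interior K') := by
  have key : ∀ k l k' l', l ≤ k' →
      Disjoint (interior (between (chain θ σ k l) (chain θ τ k l)))
        (interior (between (chain θ σ k' l') (chain θ τ k' l'))) := by
    intro k l k' l' hlk
    refine Set.disjoint_left.2 fun p hp hp' => ?_
    obtain ⟨ε, hε, hq⟩ := exists_pos_add_mem_of_mem_interior hp (0, 1)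
    obtain ⟨a, ha, -, -, hay, -⟩ := interior_subset hq
    obtain ⟨a', ha', -, -, hay', -⟩ := interior_subset hp'
    have h1 := (snd_mem_Icc_of_mem_chain hθ ha).2
    have h2 := (snd_mem_Icc_of_mem_chain hθ ha').1
    have h3 := (coneAbove_vertex hθ σ hlk).snd_le
    simp only [Prod.snd_add, Prod.smul_snd, smul_eq_mul, mul_one] at hay
    linarith
  obtain ⟨k, l, ⟨h1, h2, h3, h4, h5⟩, rfl⟩ := hK
  obtain ⟨k', l', ⟨h1', h2', h3', h4', h5'⟩, rfl⟩ := hK'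
  by_cases hlk : l ≤ k'
  · exact key _ _ _ _ hlk
  by_cases hlk' : l' ≤ k
  · exact (key _ _ _ _ hlk').symm
  have hkk : k = k' := by
    rcases lt_trichotomy k k' with h | h | h
    · exact absurd h3' (h5 k' h (by omega))
    · exact h
    · exact absurd h3 (h5' k h (by omega))
  have hll : l = l' := by
    rcases lt_trichotomy l l' with h | h | h
    · exact absurd h4 (h5' l (by omega) h)
    · exact h
    · exact absurd h4' (h5 l' (by omega) h)
  subst hkk hll
  exact absurd rfl hne

end Borders

/-! ### Sequences of borders moving to the right. -/

section Tilings

variable {n : ℕ} {θ : Fin n → ℝ} {σ : ℕ → Perm (Fin n)} {r : ℕ}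

theorem vertexwiseRight_of_le (hσ : ∀ j < r, StepRight θ (σ j) (σ (j + 1))) {i j : ℕ}
    (hij : i ≤ j) (hj : j ≤ r) : VertexwiseRight θ (σ i) (σ j) := by
  induction j, hij using Nat.le_induction with
  | base => exact fun _ => .refl _
  | succ j _ ih => exact fun k => (ih (by omega) k).trans ((hσ j hj).vertexwiseRight k)

/-- The border `σ (i + 1)` separates the two tiles: one is weakly to its left, the other weakly to
its right. Moving an interior point slightly to the right gives the contradiction. -/
theorem disjoint_interior_of_lt (hθ : IsLeftHalf θ)
    (hσ : ∀ j < r, StepRight θ (σ j) (σ (j + 1))) {i j : ℕ} (hij : i < j) (hj : j < r)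
    {K K' : Set (ℝ × ℝ)} (hK : K ∈ stepTiles θ (σ i) (σ (i + 1)))
    (hK' : K' ∈ stepTiles θ (σ j) (σ (j + 1))) : Disjoint (interior K) (interior K') := by
  refine Set.disjoint_left.2 fun p hp hp' => ?_
  obtain ⟨ε, hε, hq⟩ := exists_pos_add_mem_of_mem_interior hp (1, 0)
  obtain ⟨-, -, b, hb, -, hby, -, hbx⟩ :=
    exists_borders_of_mem_stepTiles hK (interior_subset hq)
  obtain ⟨a, ha, -, -, hay, -, hax, -⟩ :=
    exists_borders_of_mem_stepTiles hK' (interior_subset hp')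
  have hle := (vertexwiseRight_of_le hσ (Nat.succ_le_of_lt hij) hj.le).leftOf hθ b hb a ha
  simp only [Prod.fst_add, Prod.snd_add, Prod.smul_fst, Prod.smul_snd, smul_eq_mul, mul_one,
    mul_zero, add_zero] at hbx hby
  have := hle (hby.trans hay.symm)
  linarith

theorem disjoint_interior_of_ne (hθ : IsLeftHalf θ)
    (hσ : ∀ j < r, StepRight θ (σ j) (σ (j + 1))) {i j : ℕ} (hi : i < r) (hj : j < r)
    {K K' : Set (ℝ × ℝ)} (hK : K ∈ stepTiles θ (σ i) (σ (i + 1)))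
    (hK' : K' ∈ stepTiles θ (σ j) (σ (j + 1))) (hne : K ≠ K') :
    Disjoint (interior K) (interior K') := by
  rcases lt_trichotomy i j with h | rfl | h
  · exact disjoint_interior_of_lt hθ hσ h hj hK hK'
  · exact disjoint_interior_of_mem_stepTiles hθ hK hK' hne
  · exact (disjoint_interior_of_lt hθ hσ h hi hK' hK).symm

/-- A point is either weakly to the left of the last border but one, where induction applies, or
strictly to its right and hence in a tile of the last step. -/
theorem between_border_subset (hθ : IsLeftHalf θ) :
    between (border θ (σ 0)) (border θ (σ r)) ⊆
      border θ (σ 0) ∪ ⋃₀ ⋃ j < r, stepTiles θ (σ j) (σ (j + 1)) := by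
  induction r with
  | zero =>
    rintro p ⟨a, ha, b, hb, hay, hby, hax, hbx⟩
    left
    obtain rfl := eq_of_mem_chain_of_snd_eq hθ ha hb (hay.trans hby.symm)
    rwa [show p = a from Prod.ext (le_antisymm hbx hax) hay.symm]
  | succ r ih =>
    rintro p ⟨a, ha, b, hb, hay, hby, hax, hbx⟩
    obtain ⟨c, hc, hcy⟩ := exists_mem_border_snd_eq hθ (σ r) hb
    rcases le_or_gt p.1 c.1 with h | h
    · rcases ih ⟨a, ha, c, hc, hay, hcy.trans hby, hax, h⟩ with h | ⟨K, hK, hpK⟩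
      · exact .inl h
      · right
        simp only [Set.mem_iUnion] at hK
        obtain ⟨j, hj, hK⟩ := hK
        refine ⟨K, ?_, hpK⟩
        simp only [Set.mem_iUnion]
        exact ⟨j, hj.trans (Nat.lt_succ_self r), hK⟩
    · right
      obtain ⟨K, hK, hpK⟩ := StepRight.exists_tile_mem hθ hc hb (hcy.trans hby) hby h hbx
      refine ⟨K, ?_, hpK⟩
      simp only [Set.mem_iUnion]
      exact ⟨r, Nat.lt_succ_self r, hK⟩

theorem between_border_eq (hθ : IsLeftHalf θ) (hσ : ∀ j < r, StepRight θ (σ j) (σ (j + 1))) :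
    between (border θ (σ 0)) (border θ (σ r)) =
      border θ (σ 0) ∪ ⋃₀ ⋃ j < r, stepTiles θ (σ j) (σ (j + 1)) := by
  refine Set.Subset.antisymm (between_border_subset hθ) ?_
  rintro p (hp | ⟨K, hK, hpK⟩)
  · obtain ⟨b, hb, hby⟩ := exists_mem_border_snd_eq hθ (σ r) hp
    exact ⟨p, hp, b, hb, rfl, hby, le_rfl,
      (vertexwiseRight_of_le hσ (Nat.zero_le r) le_rfl).leftOf hθ p hp b hb hby.symm⟩
  · simp only [Set.mem_iUnion] at hK
    obtain ⟨j, hj, hK⟩ := hK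
    obtain ⟨a, ha, b, hb, hay, hby, hax, hbx⟩ := exists_borders_of_mem_stepTiles hK hpK
    obtain ⟨c, hc, hcy⟩ := exists_mem_border_snd_eq hθ (σ 0) ha
    obtain ⟨d, hd, hdy⟩ := exists_mem_border_snd_eq hθ (σ r) hb
    have h1 := (vertexwiseRight_of_le hσ (Nat.zero_le j) hj.le).leftOf hθ c hc a ha hcy
    have h2 := (vertexwiseRight_of_le hσ (Nat.succ_le_of_lt hj) le_rfl).leftOf hθ b hb d hd
      hdy.symm
    exact ⟨c, hc, d, hd, hcy.trans hay, hdy.trans hby, h1.trans hax, hbx.trans h2⟩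

end Tilings

/-! ### Borders along a reduced word, and the theorem. -/

section Main

variable {B W : Type*} [Group W] {M : CoxeterMatrix B} (cs : CoxeterSystem M W) {J : Set B}
  {n : ℕ} {f : W ⧸ parabolic cs J ≃ Fin n} {θ : Fin n → ℝ}

/-- Prefixes of a reduced word are reduced, so each letter increases the length and exchanges only
ascents. -/
theorem stepRight_borderPerm (hf : IsBruhatNumbering cs J f) (hθ : IsLeftHalf θ) {ω : List B}
    (hω : cs.IsReduced ω) {j : ℕ} (hj : j < ω.length) :
    StepRight θ (borderPerm cs (cosetPerm f) ω j) (borderPerm cs (cosetPerm f) ω (j + 1)) := by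
  have htake : ω.take (j + 1) = ω.take j ++ [ω[j]] := by
    rw [List.take_append_getElem]
  have hprod : cs.wordProd (ω.take (j + 1)) = cs.wordProd (ω.take j) * cs.simple ω[j] := by
    rw [htake, cs.wordProd_append, cs.wordProd_singleton]
  have hlen : cs.length (cs.wordProd (ω.take j)) <
      cs.length (cs.wordProd (ω.take j) * cs.simple ω[j]) := by
    rw [← hprod, (hω.take j).eq, (hω.take (j + 1)).eq, List.length_take, List.length_take]
    omega
  unfold borderPerm
  rw [hprod, map_mul]
  exact stepRight_mul_involution hθ _ _ (cosetPerm_simple_simple cs _)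
    (cosetPerm_lt_of_length_lt cs hf hlen)

theorem exists_isETiling (hf : IsBruhatNumbering cs J f) (hθ : IsLeftHalf θ) {ω : List B}
    (hω : cs.IsReduced ω) :
    IsETiling cs (cosetPerm f) θ (cs.wordProd ω) ω
      (⋃ j < ω.length, stepTiles θ (borderPerm cs (cosetPerm f) ω j)
        (borderPerm cs (cosetPerm f) ω (j + 1))) := by
  have hstep : ∀ j < ω.length, StepRight θ (borderPerm cs (cosetPerm f) ω j)
      (borderPerm cs (cosetPerm f) ω (j + 1)) := fun j hj => stepRight_borderPerm cs hf hθ hω hj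
  refine ⟨rfl, fun j hj => (hstep j hj).vertexwiseRight.leftOf hθ, rfl,
    fun j hj k l h => (hstep j hj).chain_inter_chain hθ h, ?_, ?_, ?_⟩
  · exact (Set.finite_lt_nat ω.length).biUnion fun j _ => finite_stepTiles _ _
  · intro K hK K' hK' hne
    simp only [Set.mem_iUnion] at hK hK'
    obtain ⟨i, hi, hK⟩ := hK
    obtain ⟨j, hj, hK'⟩ := hK'
    exact disjoint_interior_of_ne hθ hstep hi hj hK hK' hne
  · have h := between_border_eq hθ hstep
    have h0 : borderPerm cs (cosetPerm f) ω 0 = 1 := by simp [borderPerm]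
    have h1 : borderPerm cs (cosetPerm f) ω ω.length = cosetPerm f (cs.wordProd ω) := by
      simp [borderPerm]
    rwa [h0, h1] at h

end Main

theorem theorem1p1 {B W : Type*} [Group W] [Finite W] {M : CoxeterMatrix B}
    (cs : CoxeterSystem M W) (J : Set B) (hJ : (parabolic cs J).normalCore = ⊥) :
    (∃ f : W ⧸ parabolic cs J ≃ Fin (parabolic cs J).index, IsBruhatNumbering cs J f) ∧
    ∀ f : W ⧸ parabolic cs J ≃ Fin (parabolic cs J).index, IsBruhatNumbering cs J f →
      IsEEmbedding cs (cosetPerm f) ∧ IsStrongEEmbedding cs (cosetPerm f) ∧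
      ∀ θ : Fin (parabolic cs J).index → ℝ, IsLeftHalf θ →
      ∀ (w : W) (ω : List B), cs.IsReduced ω → cs.wordProd ω = w →
        ∃ T : Set (Set (ℝ × ℝ)), IsETiling cs (cosetPerm f) θ w ω T := by
  refine ⟨exists_isBruhatNumbering cs J, fun f hf => ⟨isEEmbedding_cosetPerm cs hJ hf,
    isStrongEEmbedding_cosetPerm cs hJ hf, ?_⟩⟩
  rintro θ hθ w ω hω rfl
  exact ⟨_, exists_isETiling cs hf hθ hω⟩
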